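/- Let $k\ge 0$, and let all maps be continuous. For $U\subseteq\mathbb R^k$ open, $y\in\mathbb R^k$ and $f$ an $\mathbb R^k$-valued map defined at least on $\overline U$, the triple $(f,U,y)$ is called \emph{admissible} if $f$ is proper on $\overline U$ (that is, $f|_{\overline U}$ is continuous and preimages of compact sets under it are compact) and $f(x)\ne y$ for all $x\in\partial U$. An admissible triple is \emph{regular} if $f$ is $C^\infty$ on $\overline U$ (that is, it has a $C^\infty$ extension from $\overline U$ to an open neighbourhood of $\overline U$) and the derivative $f'(x)$ is onto for every $x\in U$ with $f(x)=y$. An \emph{admissible homotopy} is a triple $(H,U,\alpha)$ where $U\subseteq\mathbb R^k$ is open, $\alpha:[0,1]\to\mathbb R^k$ is continuous, and $H$ is an $\mathbb R^k$-valued map defined at least on $\overline U\times[0,1]$ that is proper on $\overline U\times[0,1]$ and satisfies $H(x,\lambda)\ne\alpha(\lambda)$ for all $(x,\lambda)\in\partial U\times[0,1]$. The degree of a regular triple is $$\deg(f,U,y)=\sum_{x\in f^{-1}(y)\cap U}\operatorname{sign}\det f'(x).$$ The degree of an admissible triple $(f,U,y)$ is $\deg(f,U,y):=\deg(g,U,z)$,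 where $(g,U,z)$ is any regular triple such that, for some $\varepsilon,\sigma>0$ with $\varepsilon+\sigma<\operatorname{dist}(y,f(\partial U))$ (where $\operatorname{dist}(y,\emptyset)=+\infty$), one has $|g(x)-f(x)|\le\varepsilon$ for all $x\in\overline U$ and $|z-y|\le\sigma$. **Theorem.** The degree is well defined: for every regular triple $(f,U,y)$ the set $f^{-1}(y)\cap U$ is finite, and for every admissible triple $(f,U,y)$ a regular triple $(g,U,z)$ as above exists and $\deg(g,U,z)$ does not depend on its choice. Moreover, the degree has the following properties. 1. (Normalization) $(I,\mathbb R^k,0)$ is admissible and $\deg(I,\mathbb R^k,0)=1$, where $I$ is the identity of $\mathbb R^k$. 2. (Additivity) If $(f,U,y)$ is admissible and $U_1,U_2$ are disjoint open subsets of $U$ with $f^{-1}(y)\cap U\subseteq U_1\cup U_2$, then $(f,U_1,y)$ and $(f,U_2,y)$ are admissible and $\deg(f,U,y)=\deg(f,U_1,y)+\deg(f,U_2,y)$. 3. (Homotopy Invariance) If $(H,U,\alpha)$ is an admissible homotopy, then $(H(\cdot,0),U,\alpha(0))$ and $(H(\cdot,1),U,\alpha(1))$ are admissible and $\deg(H(\cdot,0),U,\alpha(0))=\deg(H(\cdot,1),U,\alpha(1))$.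 -/

import Mathlib

noncomputable section

namespace BrouwerDegree

open Set Topology

/-- `f` is proper on `S`: its restriction to `S` is continuous, and preimages of compact sets
under the restriction are compact. -/
def ProperOn {X Y : Type*} [TopologicalSpace X] [TopologicalSpace Y] (f : X → Y) (S : Set X) :
    Prop :=
  IsProperMap (S.domRestrict f)

/-- The defining property in terms of compact sets. -/
theorem properOn_iff {X Y : Type*} [TopologicalSpace X] [TopologicalSpace Y] [T2Space Y]
    [WeaklyLocallyCompactSpace Y] (f : X → Y) (S : Set X) :
    ProperOn f S ↔ ContinuousOn f S ∧ ∀ K : Set Y, IsCompact K → IsCompact (S ∩ f ⁻¹' K) := by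
  unfold ProperOn
  rw [isProperMap_iff_isCompact_preimage, continuousOn_iff_continuous_domRestrict]
  refine and_congr_right fun _ => forall_congr' fun K => imp_congr_right fun _ => ?_
  rw [Subtype.isCompact_iff, ← Subtype.image_preimage_coe S (f ⁻¹' K)]
  rfl

/-- A function is smooth on an arbitrary subset `X` of `ℝᵏ` if it has a `C^∞` extension to an open
neighbourhood of `X`. -/
def SmoothOn {k : ℕ} (f : EuclideanSpace ℝ (Fin k) → EuclideanSpace ℝ (Fin k))
    (X : Set (EuclideanSpace ℝ (Fin k))) : Prop :=
  ∃ (V : Set (EuclideanSpace ℝ (Fin k)))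
    (F : EuclideanSpace ℝ (Fin k) → EuclideanSpace ℝ (Fin k)),
    IsOpen V ∧ X ⊆ V ∧ ContDiffOn ℝ (⊤ : ℕ∞) F V ∧ EqOn F f X

/-- Admissible triples. Maps "defined at least on `closure U`" are total functions of which only
the values on `closure U` matter. -/
structure IsAdmissible {k : ℕ} (f : EuclideanSpace ℝ (Fin k) → EuclideanSpace ℝ (Fin k))
    (U : Set (EuclideanSpace ℝ (Fin k))) (y : EuclideanSpace ℝ (Fin k)) : Prop where
  isOpen : IsOpen U
  proper : ProperOn f (closure U)
  boundary : ∀ x ∈ frontier U, f x ≠ y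

/-- Regular triples: admissible, with `f` smooth on `closure U` and `y` a regular value of `f` in
`U`. -/
structure IsRegular {k : ℕ} (f : EuclideanSpace ℝ (Fin k) → EuclideanSpace ℝ (Fin k))
    (U : Set (EuclideanSpace ℝ (Fin k))) (y : EuclideanSpace ℝ (Fin k)) : Prop where
  admissible : IsAdmissible f U y
  smooth : SmoothOn f (closure U)
  regular : ∀ x ∈ U, f x = y → Function.Surjective (fderiv ℝ f x)

/-- The index of `f` at `x`: the sign of the Jacobian determinant. -/
def index {k : ℕ} (f : EuclideanSpace ℝ (Fin k) → EuclideanSpace ℝ (Fin k))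
    (x : EuclideanSpace ℝ (Fin k)) : ℤ :=
  (SignType.sign (fderiv ℝ f x).det : ℤ)

/-- The Brouwer degree of a regular triple. (The index set is finite for regular triples.) -/
def regularDegree {k : ℕ} (f : EuclideanSpace ℝ (Fin k) → EuclideanSpace ℝ (Fin k))
    (U : Set (EuclideanSpace ℝ (Fin k))) (y : EuclideanSpace ℝ (Fin k)) : ℤ :=
  ∑ᶠ x ∈ f ⁻¹' {y} ∩ U, index f x

/-- `(g, U, z)` is a regular triple that may be used to compute the degree of `(f, U, y)`: `g` is
`ε`-close to `f` on `closure U`, `z` is `σ`-close to `y`, and `ε + σ < dist (y, f (∂U))`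
(this distance is `∞` if `∂U` is empty). -/
def IsRegularApprox {k : ℕ} (f : EuclideanSpace ℝ (Fin k) → EuclideanSpace ℝ (Fin k))
    (U : Set (EuclideanSpace ℝ (Fin k))) (y : EuclideanSpace ℝ (Fin k))
    (g : EuclideanSpace ℝ (Fin k) → EuclideanSpace ℝ (Fin k))
    (z : EuclideanSpace ℝ (Fin k)) : Prop :=
  IsRegular g U z ∧ ∃ ε σ : ℝ, 0 < ε ∧ 0 < σ ∧
    (∀ x ∈ closure U, ‖g x - f x‖ ≤ ε) ∧ ‖z - y‖ ≤ σ ∧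
    ENNReal.ofReal (ε + σ) < Metric.infEDist y (f '' frontier U)

open Classical in
/-- The Brouwer degree of an admissible triple: the degree of any regular triple approximating it
(junk value `0` if there is none). -/
def degree {k : ℕ} (f : EuclideanSpace ℝ (Fin k) → EuclideanSpace ℝ (Fin k))
    (U : Set (EuclideanSpace ℝ (Fin k))) (y : EuclideanSpace ℝ (Fin k)) : ℤ :=
  if h : ∃ p : (EuclideanSpace ℝ (Fin k) → EuclideanSpace ℝ (Fin k)) × EuclideanSpace ℝ (Fin k),
      IsRegularApprox f U y p.1 p.2 then
    regularDegree h.choose.1 U h.choose.2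
  else 0

/-- Admissible homotopies of triples; `α` is a path on `[0,1]`. -/
structure IsAdmissibleHomotopy {k : ℕ}
    (H : EuclideanSpace ℝ (Fin k) × ℝ → EuclideanSpace ℝ (Fin k))
    (U : Set (EuclideanSpace ℝ (Fin k))) (α : ℝ → EuclideanSpace ℝ (Fin k)) : Prop where
  isOpen : IsOpen U
  path : ContinuousOn α (Icc 0 1)
  proper : ProperOn H (closure U ×ˢ Icc (0 : ℝ) 1)
  boundary : ∀ x ∈ frontier U, ∀ t ∈ Icc (0 : ℝ) 1, H (x, t) ≠ α t

end BrouwerDegree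

end

/-! The degree of a regular triple is read off from an integral. If `φ` is a bump at `0` with small
support and `χ` is a cutoff supported in `U`, equal to `1` near the solutions of `g = z`, then
changing variables around each solution turns `∫ χ · φ(g - z) · det g'` into the sum of the Jacobian
signs times `∫ φ` (`exists_integral_eq_sum_sign`).

The integral does not change along an affine homotopy `h_t` with velocity `w`. The `t`-derivative of
`φ(h_t) det h_t'` is the divergence of the field `φ(h_t) adj(h_t') w`, because the second-order
terms cancel by symmetry of `h_t''`. Integrated against `χ` it gives zero, provided `φ(h_t)`
vanishes where `χ' ≠ 0` (`integral_affine_family_eq`). For two regular approximations of one triple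
the required gap `ε + σ < dist (y, f(∂U))` is what allows such `χ` and `φ`, so their degrees agree.
Existence of approximations is smoothing plus Sard's theorem.

For additivity, one approximation serves all three sets. For homotopy invariance, excision reduces
to a domain with compact closure, on which the degree is locally constant in `t`. On unbounded `U`,
properness replaces the missing compactness throughout. -/

namespace BrouwerDegree

open Set Topology MeasureTheory Filter
open scoped ContDiff Manifold

/-! ### Determinants, cofactors and their divergence -/

section Determinant

variable {ι E : Type*} [Fintype ι] [DecidableEq ι] [NormedAddCommGroup E] [NormedSpace ℝ E]
  [FiniteDimensional ℝ E]

/-- The determinant with respect to a basis as a continuous multilinear map. -/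
noncomputable def detCML (e : Module.Basis ι ℝ E) : ContinuousMultilinearMap ℝ (fun _ : ι => E) ℝ where
  toMultilinearMap := e.det.toMultilinearMap
  cont := by
    change Continuous fun v : ι → E => e.det v
    simp only [Module.Basis.det_apply]
    refine Continuous.matrix_det (continuous_matrix fun i j => ?_)
    exact ((e.coord i).continuous_of_finiteDimensional).comp (continuous_apply j)

theorem detCML_apply (e : Module.Basis ι ℝ E) (v : ι → E) : detCML e v = e.det v := rfl

theorem detCML_map_basis (e : Module.Basis ι ℝ E) (L : E →L[ℝ] E) :
    detCML e (fun i => L (e i)) = L.det := by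
  have := e.det_comp (L : E →ₗ[ℝ] E) e
  rw [e.det_self, mul_one] at this
  exact this

/-- Cramer's rule. -/
theorem sum_detCML_update_smul (e : Module.Basis ι ℝ E) (v : ι → E) (w : E) :
    ∑ j, detCML e (Function.update v j w) • v j = detCML e v • w := by
  have h := Matrix.mulVec_cramer (e.toMatrix v) (e.repr w)
  apply e.repr.injective
  ext i
  have hi := congrFun h i
  simp only [Matrix.mulVec, dotProduct, Pi.smul_apply] at hi
  simp only [map_sum, map_smul, Finsupp.coe_finsetSum, Finset.sum_apply, Finsupp.smul_apply,
    detCML_apply, Module.Basis.det_apply]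
  rw [← hi]
  refine Finset.sum_congr rfl fun j _ => ?_
  rw [Matrix.cramer_apply, Module.Basis.toMatrix_update, smul_eq_mul, mul_comm]
  rfl

/-- The mixed second order terms in the divergence of a cofactor field cancel. -/
theorem sum_sum_detCML_update_update_eq_zero (e : Module.Basis ι ℝ E) (v : ι → E) (w : E)
    (s : ι → ι → E) (hs : ∀ i j, s i j = s j i) :
    ∑ j, ∑ l ∈ Finset.univ.erase j,
      detCML e (Function.update (Function.update v j w) l (s j l)) = 0 := by
  set T : ι → ι → ℝ := fun j l =>
    if l = j then 0 else detCML e (Function.update (Function.update v j w) l (s j l)) with hT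
  have hanti : ∀ j l, T l j = - T j l := by
    intro j l
    by_cases h : l = j
    · simp [hT, h]
    · simp only [hT, h, Ne.symm h, if_false, detCML_apply]
      -- Both determinants carry `w` in column `j` and the mixed term in column `l` after one
      -- transposition of columns, which costs a sign.
      rw [← e.det.map_swap _ h, hs]
      congr 1
      ext1 m
      rcases eq_or_ne m j with rfl | hmj
      · simp
      · rcases eq_or_ne m l with rfl | hml
        · rw [Function.comp_apply, Equiv.swap_apply_left, Function.update_of_ne hmj,
            Function.update_self, Function.update_of_ne (Ne.symm hmj), Function.update_self]
        · simp [Equiv.swap_apply_of_ne_of_ne hml hmj, Function.update_of_ne hml,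
            Function.update_of_ne hmj]
  have h1 : ∑ j, ∑ l ∈ Finset.univ.erase j,
      detCML e (Function.update (Function.update v j w) l (s j l)) = ∑ j, ∑ l, T j l := by
    refine Finset.sum_congr rfl fun j _ => ?_
    rw [← Finset.sum_erase (s := Finset.univ) (a := j) (f := fun l => T j l) (by simp [hT])]
    refine Finset.sum_congr rfl fun l hl => ?_
    simp [hT, Finset.ne_of_mem_erase hl]
  rw [h1]
  have h2 : ∑ j, ∑ l, T j l = - ∑ j, ∑ l, T j l := by
    conv_lhs => rw [Finset.sum_comm]
    rw [← Finset.sum_neg_distrib]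
    refine Finset.sum_congr rfl fun j _ => ?_
    rw [← Finset.sum_neg_distrib]
    exact Finset.sum_congr rfl fun l _ => hanti j l
  linarith

/-- The divergence of `φ (h x) • adj (h' x) (w x)`. -/
theorem sum_fderiv_cofactor_field (e : Module.Basis ι ℝ E) {φ : E → ℝ} {h w : E → E} {x : E}
    (hφ : DifferentiableAt ℝ φ (h x)) (hh : ContDiffAt ℝ 2 h x) (hw : DifferentiableAt ℝ w x) :
    ∑ j, fderiv ℝ (fun x => φ (h x) *
      detCML e (Function.update (fun l => fderiv ℝ h x (e l)) j (w x))) x (e j) =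
    fderiv ℝ φ (h x) (w x) * detCML e (fun l => fderiv ℝ h x (e l)) +
      φ (h x) * ∑ j, detCML e
        (Function.update (fun l => fderiv ℝ h x (e l)) j (fderiv ℝ w x (e j))) := by
  set A : ι → E := fun l => fderiv ℝ h x (e l) with hA
  have hh1 : HasFDerivAt h (fderiv ℝ h x) x := (hh.differentiableAt (by norm_num)).hasFDerivAt
  have hh2 : HasFDerivAt (fderiv ℝ h) (fderiv ℝ (fderiv ℝ h) x) x :=
    ((hh.fderiv_right (m := 1) (by norm_num)).differentiableAt (by norm_num)).hasFDerivAt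
  have hsymm : IsSymmSndFDerivAt ℝ h x := hh.isSymmSndFDerivAt (by simp)
  -- Product rule, split by which factor is differentiated: `φ ∘ h`, the column `w`, or another
  -- column. Summed over `j`, Cramer's rule collapses the first group, and the third cancels by
  -- symmetry of the second derivative.
  have key : ∀ j, fderiv ℝ (fun x => φ (h x) *
      detCML e (Function.update (fun l => fderiv ℝ h x (e l)) j (w x))) x (e j) =
      fderiv ℝ φ (h x) (detCML e (Function.update A j (w x)) • A j) +
      φ (h x) * detCML e (Function.update A j (fderiv ℝ w x (e j))) +
      φ (h x) * ∑ l ∈ Finset.univ.erase j, detCML e (Function.update (Function.update A j (w x)) l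
        (fderiv ℝ (fderiv ℝ h) x (e j) (e l))) := by
    intro j
    have hcols : ∀ l, HasFDerivAt
        (fun x => Function.update (fun l => fderiv ℝ h x (e l)) j (w x) l)
        (if l = j then fderiv ℝ w x else
          (ContinuousLinearMap.apply ℝ E (e l)).comp (fderiv ℝ (fderiv ℝ h) x)) x := by
      intro l
      rcases eq_or_ne l j with rfl | hl
      · simpa using hw.hasFDerivAt
      · simp only [Function.update_of_ne hl, if_neg hl]
        exact (ContinuousLinearMap.apply ℝ E (e l)).hasFDerivAt.comp x hh2
    have hD := HasFDerivAt.multilinear_comp (detCML e) hcols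
    have hφh := hφ.hasFDerivAt.comp x hh1
    have hmul := hφh.mul hD
    have e1 := hmul.fderiv
    simp only [Function.comp_def] at e1
    change fderiv ℝ (fun x => φ (h x) *
      detCML e (Function.update (fun l => fderiv ℝ h x (e l)) j (w x))) x = _ at e1
    rw [e1]
    simp only [add_apply, smul_apply,
      sum_apply, ContinuousLinearMap.comp_apply, smul_eq_mul, map_smul]
    rw [← Finset.add_sum_erase _ _ (Finset.mem_univ j), mul_add, add_comm, ← add_assoc]
    congr 1
    · congr 1
      simp [ContinuousMultilinearMap.toContinuousLinearMap, hA]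
    · congr 1
      refine Finset.sum_congr rfl fun l hl => ?_
      rw [if_neg (Finset.ne_of_mem_erase hl)]
      rfl
  rw [Finset.sum_congr rfl fun j _ => key j, Finset.sum_add_distrib, Finset.sum_add_distrib,
    ← map_sum, sum_detCML_update_smul, ← Finset.mul_sum, ← Finset.mul_sum,
    sum_sum_detCML_update_update_eq_zero e A (w x) _ (fun i j => hsymm.eq _ _), map_smul]
  simp [mul_comm]

/-- The derivative in the parameter of `φ (hₜ x) * det (hₜ' x)` for an affine family `hₜ`. -/
theorem hasDerivAt_affine_family (e : Module.Basis ι ℝ E) {φ : E → ℝ} {a w : E → E} {x : E} {t : ℝ}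
    (hφ : DifferentiableAt ℝ φ (a x + t • w x)) :
    HasDerivAt (fun t : ℝ => φ (a x + t • w x) * (fderiv ℝ a x + t • fderiv ℝ w x).det)
      (fderiv ℝ φ (a x + t • w x) (w x) *
          detCML e (fun l => (fderiv ℝ a x + t • fderiv ℝ w x) (e l)) +
        φ (a x + t • w x) * ∑ j, detCML e
          (Function.update (fun l => (fderiv ℝ a x + t • fderiv ℝ w x) (e l)) j
            (fderiv ℝ w x (e j)))) t := by
  have aff : ∀ (p q : E), HasDerivAt (fun t : ℝ => p + t • q) q t := fun p q => by
    simpa using ((hasDerivAt_id t).smul_const q).const_add p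
  have h1 : HasDerivAt (fun t : ℝ => φ (a x + t • w x)) (fderiv ℝ φ (a x + t • w x) (w x)) t :=
    hφ.hasFDerivAt.comp_hasDerivAt t (aff _ _)
  have h2 : HasDerivAt (fun t : ℝ => (fderiv ℝ a x + t • fderiv ℝ w x).det)
      (∑ j, detCML e (Function.update (fun l => (fderiv ℝ a x + t • fderiv ℝ w x) (e l)) j
            (fderiv ℝ w x (e j)))) t := by
    have := HasFDerivAt.multilinear_comp (detCML e)
      (fun l => (aff (fderiv ℝ a x (e l)) (fderiv ℝ w x (e l))).hasFDerivAt)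
    have h3 := this.hasDerivAt
    have h4 : (fun t : ℝ => (fderiv ℝ a x + t • fderiv ℝ w x).det) = fun t : ℝ =>
        detCML e (fun l => fderiv ℝ a x (e l) + t • fderiv ℝ w x (e l)) := by
      funext t
      rw [← detCML_map_basis e]
      rfl
    rw [h4]
    refine h3.congr_deriv ?_
    simp [ContinuousMultilinearMap.toContinuousLinearMap]
  simp only [detCML_map_basis]
  exact h1.mul h2

end Determinant

/-! ### The degree integral along affine homotopies -/

section Homotopy

variable {E : Type*} [NormedAddCommGroup E] [NormedSpace ℝ E]
  [FiniteDimensional ℝ E] [MeasurableSpace E] [BorelSpace E]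

/-- The integral of a cut off divergence vanishes if the field vanishes wherever the cutoff is not
locally constant. -/
theorem integral_mul_sum_fderiv_eq_zero {ι : Type*} [Fintype ι] (μ : Measure E)
    [μ.IsAddHaarMeasure] {χ : E → ℝ} {Y : ι → E → ℝ} (e : ι → E)
    (hχ : ContDiff ℝ 1 χ) (hχc : HasCompactSupport χ) (hY : ∀ j, ContDiff ℝ 1 (Y j))
    (hsupp : ∀ x, fderiv ℝ χ x ≠ 0 → ∀ j, Y j x = 0) :
    ∫ x, χ x * ∑ j, fderiv ℝ (Y j) x (e j) ∂μ = 0 := by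
  have cY : ∀ j, Continuous fun x => fderiv ℝ (Y j) x (e j) := fun j =>
    ((hY j).continuous_fderiv (by norm_num)).clm_apply continuous_const
  have hint : ∀ j, Integrable (fun x => χ x * fderiv ℝ (Y j) x (e j)) μ := fun j =>
    (hχ.continuous.mul (cY j)).integrable_of_hasCompactSupport hχc.mul_right
  simp only [Finset.mul_sum]
  rw [integral_finsetSum _ fun j _ => hint j]
  refine Finset.sum_eq_zero fun j _ => ?_
  have hz : ∀ x, fderiv ℝ χ x (e j) * Y j x = 0 := by
    intro x
    by_cases hx : fderiv ℝ χ x = 0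
    · simp [hx]
    · simp [hsupp x hx j]
  rw [integral_mul_fderiv_eq_neg_fderiv_mul_of_integrable (by simp [hz]) (hint j)
    ((hχ.continuous.mul (hY j).continuous).integrable_of_hasCompactSupport hχc.mul_right)
    (fun x _ => hχ.differentiable (by norm_num) x)
    (fun x _ => (hY j).differentiable (by norm_num) x)]
  simp [hz]

/-- Invariance of the degree integral along an affine homotopy. -/
theorem integral_affine_family_eq (μ : Measure E) [μ.IsAddHaarMeasure] {χ φ : E → ℝ} {a w : E → E}
    (hχ : ContDiff ℝ 1 χ) (hχc : HasCompactSupport χ) (hφ : ContDiff ℝ 1 φ)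
    (ha : ContDiff ℝ 2 a) (hw : ContDiff ℝ 2 w)
    (hsupp : ∀ t ∈ Icc (0 : ℝ) 1, ∀ x, fderiv ℝ χ x ≠ 0 → φ (a x + t • w x) = 0) :
    ∫ x, χ x * (φ (a x) * (fderiv ℝ a x).det) ∂μ =
      ∫ x, χ x * (φ (a x + w x) * (fderiv ℝ (fun x => a x + w x) x).det) ∂μ := by
  classical
  let e := Module.finBasis ℝ E
  set Ψ : ℝ → E → ℝ := fun t x => fderiv ℝ φ (a x + t • w x) (w x) *
          detCML e (fun l => (fderiv ℝ a x + t • fderiv ℝ w x) (e l)) +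
        φ (a x + t • w x) * ∑ j, detCML e
          (Function.update (fun l => (fderiv ℝ a x + t • fderiv ℝ w x) (e l)) j
            (fderiv ℝ w x (e j))) with hΨ
  have ca' : Continuous (fderiv ℝ a) := ha.continuous_fderiv (by norm_num)
  have cw' : Continuous (fderiv ℝ w) := hw.continuous_fderiv (by norm_num)
  have ca := ha.continuous
  have cw := hw.continuous
  have cφ := hφ.continuous
  have cφ' : Continuous (fderiv ℝ φ) := hφ.continuous_fderiv (by norm_num)
  have cA : Continuous fun p : ℝ × E =>
      fun l => (fderiv ℝ a p.2 + p.1 • fderiv ℝ w p.2) (e l) := by fun_prop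
  have cΨ : Continuous (Function.uncurry Ψ) := by
    have c1 : Continuous fun p : ℝ × E => detCML e
        (fun l => (fderiv ℝ a p.2 + p.1 • fderiv ℝ w p.2) (e l)) := (detCML e).cont.comp cA
    have c2 : ∀ j, Continuous fun p : ℝ × E => detCML e
        (Function.update (fun l => (fderiv ℝ a p.2 + p.1 • fderiv ℝ w p.2) (e l)) j
            (fderiv ℝ w p.2 (e j))) := fun j =>
      (detCML e).cont.comp (cA.update j (by fun_prop))
    have c3 : Continuous fun p : ℝ × E => ∑ j, detCML e
        (Function.update (fun l => (fderiv ℝ a p.2 + p.1 • fderiv ℝ w p.2) (e l)) j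
            (fderiv ℝ w p.2 (e j))) := continuous_finsetSum _ fun j _ => c2 j
    have c4 : Continuous fun p : ℝ × E => fderiv ℝ φ (a p.2 + p.1 • w p.2) (w p.2) := by fun_prop
    have c5 : Continuous fun p : ℝ × E => φ (a p.2 + p.1 • w p.2) := by fun_prop
    exact (c4.mul c1).add (c5.mul c3)
  have hderiv : ∀ x t, HasDerivAt
      (fun t : ℝ => φ (a x + t • w x) * (fderiv ℝ a x + t • fderiv ℝ w x).det) (Ψ t x) t :=
    fun x t => hasDerivAt_affine_family e (hφ.differentiable (by norm_num) _)
  -- For fixed `t`, `Ψ t` is the divergence of the cofactor field, whose factor `φ (h x)` vanishes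
  -- wherever `χ' ≠ 0`.
  have hzero : ∀ t ∈ Icc (0 : ℝ) 1, ∫ x, χ x * Ψ t x ∂μ = 0 := by
    intro t ht
    set h : E → E := fun x => a x + t • w x with hh
    have ch : ContDiff ℝ 2 h := ha.add (contDiff_const.smul hw)
    have hfd : ∀ x, fderiv ℝ h x = fderiv ℝ a x + t • fderiv ℝ w x := by
      intro x
      have h1 := ha.differentiable (by norm_num) x
      have h2 := hw.differentiable (by norm_num) x
      exact (h1.hasFDerivAt.add (h2.hasFDerivAt.const_smul t)).fderiv
    have hYc : ∀ j, ContDiff ℝ 1 (fun x => φ (h x) *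
        detCML e (Function.update (fun l => fderiv ℝ h x (e l)) j (w x))) := by
      intro j
      refine (hφ.comp (ch.of_le (by norm_num))).mul ((detCML e).contDiff.comp ?_)
      rw [contDiff_pi]
      intro l
      rcases eq_or_ne l j with rfl | hl
      · simpa using hw.of_le (by norm_num)
      · simpa only [Function.update_of_ne hl] using
          (ch.fderiv_right (m := 1) (by norm_num)).clm_apply contDiff_const
    have := integral_mul_sum_fderiv_eq_zero μ e hχ hχc hYc
      (fun x hx j => by rw [hsupp t ht x hx, zero_mul])
    rw [← this]
    refine integral_congr_ae (.of_forall fun x => ?_)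
    simp only
    rw [sum_fderiv_cofactor_field e (hφ.differentiable (by norm_num) _) ch.contDiffAt
      (hw.differentiable (by norm_num) x)]
    simp only [hfd]
    rfl
  have hftc : ∀ x, φ (a x + w x) * (fderiv ℝ (fun x => a x + w x) x).det -
      φ (a x) * (fderiv ℝ a x).det = ∫ t in (0 : ℝ)..1, Ψ t x := by
    intro x
    rw [intervalIntegral.integral_eq_sub_of_hasDerivAt (fun t _ => hderiv x t)
      ((cΨ.comp (by fun_prop : Continuous fun t : ℝ => (t, x))).intervalIntegrable _ _)]
    have h1 := ha.differentiable (by norm_num) x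
    have h2 := hw.differentiable (by norm_num) x
    simp [fderiv_fun_add h1 h2]
  have hdet : ∀ {f : E → E}, ContDiff ℝ 2 f → Continuous fun x => (fderiv ℝ f x).det := fun hf =>
    ContinuousLinearMap.continuous_det.comp (hf.continuous_fderiv (by norm_num))
  have hi0 : Integrable (fun x => χ x * (φ (a x) * (fderiv ℝ a x).det)) μ :=
    (hχ.continuous.mul ((cφ.comp ca).mul (hdet ha))).integrable_of_hasCompactSupport hχc.mul_right
  have hi1 : Integrable
      (fun x => χ x * (φ (a x + w x) * (fderiv ℝ (fun x => a x + w x) x).det)) μ :=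
    (hχ.continuous.mul ((cφ.comp (ca.add cw)).mul (hdet (ha.add hw)))).integrable_of_hasCompactSupport
      hχc.mul_right
  refine (sub_eq_zero.1 ?_).symm
  rw [← integral_sub hi1 hi0]
  calc ∫ x, (χ x * (φ (a x + w x) * (fderiv ℝ (fun x => a x + w x) x).det) -
          χ x * (φ (a x) * (fderiv ℝ a x).det)) ∂μ
      = ∫ x, ∫ t in Ioc (0 : ℝ) 1, χ x * Ψ t x ∂volume ∂μ := by
        refine integral_congr_ae (.of_forall fun x => ?_)
        simp only
        rw [← mul_sub, hftc, intervalIntegral.integral_of_le zero_le_one, integral_const_mul]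
    _ = ∫ t in Ioc (0 : ℝ) 1, ∫ x, χ x * Ψ t x ∂μ ∂volume := by
        refine integral_integral_swap ?_
        have cF : Continuous fun p : E × ℝ => χ p.1 * Ψ p.2 p.1 :=
          (hχ.continuous.comp continuous_fst).mul (cΨ.comp continuous_swap)
        have hK : IsCompact (tsupport χ ×ˢ Icc (0 : ℝ) 1) := hχc.isCompact.prod isCompact_Icc
        -- Fubini on the whole space is legitimate because the continuous integrand vanishes off
        -- `tsupport χ` in the first variable.
        have h1 : IntegrableOn (fun p : E × ℝ => χ p.1 * Ψ p.2 p.1) (univ ×ˢ Ioc (0 : ℝ) 1)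
            (μ.prod volume) := by
          refine (cF.continuousOn.integrableOn_compact hK).of_forall_sdiff_eq_zero
            (MeasurableSet.univ.prod measurableSet_Ioc) ?_
          rintro ⟨x, t⟩ ⟨⟨-, ht⟩, hn⟩
          have : x ∉ tsupport χ := fun hx => hn ⟨hx, Ioc_subset_Icc_self ht⟩
          simp [image_eq_zero_of_notMem_tsupport this]
        rw [IntegrableOn, ← Measure.prod_restrict, Measure.restrict_univ] at h1
        exact h1
    _ = 0 := by
        refine (setIntegral_congr_fun measurableSet_Ioc fun t ht =>
          hzero t (Ioc_subset_Icc_self ht)).trans ?_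
        simp

end Homotopy

/-! ### Regular zeros and change of variables -/

section Regular

variable {E : Type*} [NormedAddCommGroup E] [NormedSpace ℝ E] [FiniteDimensional ℝ E]

theorem det_ne_zero_iff_surjective (L : E →L[ℝ] E) : L.det ≠ 0 ↔ Function.Surjective L := by
  rw [← isUnit_iff_ne_zero]
  change IsUnit (LinearMap.det (L : E →ₗ[ℝ] E)) ↔ _
  rw [← LinearMap.isUnit_iff_isUnit_det, LinearMap.isUnit_iff_range_eq_top, LinearMap.range_eq_top]
  rfl

/-- A `C¹` map is injective, with Jacobian of constant sign and open image, near a point where its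
derivative is invertible. -/
theorem exists_isOpen_injOn_sign_det {G : E → E} (hG : ContDiff ℝ 1 G) {x : E}
    (hx : (fderiv ℝ G x).det ≠ 0) {W : Set E} (hW : W ∈ 𝓝 x) :
    ∃ N : Set E, IsOpen N ∧ x ∈ N ∧ N ⊆ W ∧ InjOn G N ∧ G '' N ∈ 𝓝 (G x) ∧
      ∀ y ∈ N, SignType.sign (fderiv ℝ G y).det = SignType.sign (fderiv ℝ G x).det := by
  have hs : HasStrictFDerivAt G
      (((fderiv ℝ G x).toContinuousLinearEquivOfDetNeZero hx : E ≃L[ℝ] E) : E →L[ℝ] E) x := by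
    rw [ContinuousLinearMap.coe_toContinuousLinearEquivOfDetNeZero]
    exact hG.contDiffAt.hasStrictFDerivAt (by norm_num)
  have hcont : Continuous fun y => (fderiv ℝ G y).det * (fderiv ℝ G x).det :=
    (ContinuousLinearMap.continuous_det.comp (hG.continuous_fderiv (by norm_num))).mul
      continuous_const
  have hpos : IsOpen {y | 0 < (fderiv ℝ G y).det * (fderiv ℝ G x).det} :=
    isOpen_lt continuous_const hcont
  have hNo : IsOpen ((hs.toOpenPartialHomeomorph G).source ∩ interior W ∩
      {y | 0 < (fderiv ℝ G y).det * (fderiv ℝ G x).det}) :=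
    (((hs.toOpenPartialHomeomorph G).open_source.inter isOpen_interior).inter hpos)
  have hxN : x ∈ (hs.toOpenPartialHomeomorph G).source ∩ interior W ∩
      {y | 0 < (fderiv ℝ G y).det * (fderiv ℝ G x).det} :=
    ⟨⟨hs.mem_toOpenPartialHomeomorph_source, mem_interior_iff_mem_nhds.2 hW⟩,
      mul_self_pos.2 hx⟩
  refine ⟨_, hNo, hxN, fun y hy => interior_subset hy.1.2, ?_, ?_, ?_⟩
  · exact (hs.toOpenPartialHomeomorph G).injOn.mono fun y hy => hy.1.1
  · rw [← hs.map_nhds_eq_of_equiv]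
    exact image_mem_map (hNo.mem_nhds hxN)
  · rintro y ⟨-, hy⟩
    rcases pos_and_pos_or_neg_and_neg_of_mul_pos (mem_ofPred_eq ▸ hy) with ⟨h1, h2⟩ | ⟨h1, h2⟩
    · rw [sign_pos h1, sign_pos h2]
    · rw [sign_neg h1, sign_neg h2]

/-- A compact set of regular points on a single level is finite. -/
theorem finite_of_isCompact_of_det_ne_zero {G : E → E} (hG : ContDiff ℝ 1 G) {K : Set E}
    (hK : IsCompact K) {y : E} (hy : ∀ x ∈ K, G x = y) (hdet : ∀ x ∈ K, (fderiv ℝ G x).det ≠ 0) :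
    K.Finite := by
  have : ∀ x ∈ K, ∃ N ∈ 𝓝 x, K ∩ N ⊆ {x} := by
    intro x hx
    obtain ⟨N, hNo, hxN, -, hinj, -⟩ := exists_isOpen_injOn_sign_det hG (hdet x hx) univ_mem
    exact ⟨N, hNo.mem_nhds hxN, fun z hz => hinj hz.2 hxN ((hy z hz.1).trans (hy x hx).symm)⟩
  choose! N hN hsub using this
  obtain ⟨t, htK, ht⟩ := hK.elim_nhds_subcover N hN
  refine t.finite_toSet.subset fun z hz => ?_
  obtain ⟨x, hx, hzx⟩ := mem_iUnion₂.1 (ht hz)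
  have : z = x := hsub x (htK x hx) ⟨hz, hzx⟩
  exact this ▸ hx

variable [MeasurableSpace E] [BorelSpace E]

/-- The degree integral of a map with regular zeros computes the sum of the signs of the
Jacobian. -/
theorem exists_integral_eq_sum_sign (μ : Measure E) [μ.IsAddHaarMeasure] {χ : E → ℝ} {G : E → E}
    (hG : ContDiff ℝ 1 G) (hχ : Continuous χ) (hχc : HasCompactSupport χ) (Z : Finset E)
    (hZ : ∀ x ∈ tsupport χ, G x = 0 → x ∈ Z) (hZ0 : ∀ x ∈ Z, G x = 0)
    (hZχ : ∀ x ∈ Z, ∀ᶠ y in 𝓝 x, χ y = 1) (hZdet : ∀ x ∈ Z, (fderiv ℝ G x).det ≠ 0) :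
    ∃ r > 0, ∀ φ : E → ℝ, Continuous φ → (∀ u, r ≤ ‖u‖ → φ u = 0) →
      ∫ x, χ x * (φ (G x) * (fderiv ℝ G x).det) ∂μ =
        ((∑ x ∈ Z, (SignType.sign (fderiv ℝ G x).det : ℤ) : ℤ) : ℝ) * ∫ u, φ u ∂μ := by
  obtain ⟨W, hW, hWd⟩ := Z.finite_toSet.t2_separation
  have hloc : ∀ x ∈ Z, ∃ N : Set E, IsOpen N ∧ x ∈ N ∧ N ⊆ W x ∩ {y | χ y = 1} ∧ InjOn G N ∧
      G '' N ∈ 𝓝 (G x) ∧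
      ∀ y ∈ N, SignType.sign (fderiv ℝ G y).det = SignType.sign (fderiv ℝ G x).det :=
    fun x hx => exists_isOpen_injOn_sign_det hG (hZdet x hx)
      (inter_mem ((hW x).2.mem_nhds (hW x).1) (hZχ x hx))
  choose! N hNo hxN hNW hinj himg hsign using hloc
  -- On this compact remainder `G` has no zero, so `‖G‖ ≥ r₁ > 0` there; a `φ` supported in radius
  -- `r < r₁` sees only the neighbourhoods `N x`.
  have hC : IsCompact (tsupport χ \ ⋃ x ∈ Z, N x) :=
    hχc.isCompact.diff (isOpen_biUnion hNo)
  obtain ⟨r₁, hr₁, hr₁C⟩ := hC.exists_forall_le' (f := fun x => ‖G x‖) (a := 0)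
    hG.continuous.norm.continuousOn (by
      rintro x ⟨hx, hxN'⟩
      refine norm_pos_iff.2 fun h0 => hxN' ?_
      exact mem_biUnion (hZ x hx h0) (hxN x (hZ x hx h0)))
  have hρ : ∀ x ∈ Z, ∀ᶠ r in 𝓝[>] (0 : ℝ), Metric.ball 0 r ⊆ G '' N x := by
    intro x hx
    obtain ⟨ρ, hρ, hb⟩ := Metric.mem_nhds_iff.1 (himg x hx)
    rw [hZ0 x hx] at hb
    filter_upwards [Ioo_mem_nhdsGT hρ] with r hr
    exact (Metric.ball_subset_ball hr.2.le).trans hb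
  obtain ⟨r, ⟨hrZ, hr0⟩, hrr₁⟩ := (((eventually_all_finset Z).2 hρ).and (Ioo_mem_nhdsGT hr₁)).exists.imp
    fun r hr => (⟨⟨hr.1, hr.2.1⟩, hr.2.2⟩ :
      ((∀ x ∈ Z, Metric.ball 0 r ⊆ G '' N x) ∧ 0 < r) ∧ r < r₁)
  refine ⟨r, hr0, fun φ hφ hφr => ?_⟩
  have hcF : Continuous fun x => χ x * (φ (G x) * (fderiv ℝ G x).det) :=
    hχ.mul ((hφ.comp hG.continuous).mul
      (ContinuousLinearMap.continuous_det.comp (hG.continuous_fderiv (by norm_num))))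
  have hiF : Integrable (fun x => χ x * (φ (G x) * (fderiv ℝ G x).det)) μ :=
    hcF.integrable_of_hasCompactSupport hχc.mul_right
  rw [← setIntegral_eq_integral_of_forall_compl_eq_zero (s := ⋃ x ∈ Z, N x) (by
    intro x hx
    by_cases hxs : x ∈ tsupport χ
    · rw [hφr _ (hrr₁.le.trans (hr₁C x ⟨hxs, hx⟩)), zero_mul, mul_zero]
    · rw [image_eq_zero_of_notMem_tsupport hxs, zero_mul])]
  rw [integral_biUnion_finset Z (fun x hx => (hNo x hx).measurableSet)
    (fun x hx y hy hxy => (hWd hx hy hxy).mono (fun z hz => (hNW x hx hz).1)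
      (fun z hz => (hNW y hy hz).1)) (fun x _ => hiF.integrableOn)]
  rw [Int.cast_sum, Finset.sum_mul]
  refine Finset.sum_congr rfl fun x hx => ?_
  -- The image `G '' N x` contains the ball of radius `r`, so the integral of `φ` over it is the
  -- full integral.
  have hcv := integral_image_eq_integral_abs_det_fderiv_smul μ (hNo x hx).measurableSet
    (fun y _ => (hG.differentiable (by norm_num) y).hasFDerivAt.hasFDerivWithinAt) (hinj x hx) φ
  rw [setIntegral_eq_integral_of_forall_compl_eq_zero (s := G '' N x) (by
    intro u hu
    refine hφr u (le_of_not_gt fun hlt => hu (hrZ x hx ?_))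
    simpa using hlt)] at hcv
  rw [hcv, ← integral_const_mul]
  refine setIntegral_congr_fun (hNo x hx).measurableSet fun y hy => ?_
  have h1 : χ y = 1 := (hNW x hx hy).2
  simp only [h1, one_mul, smul_eq_mul]
  rw [← hsign x hx y hy, ← mul_assoc]
  have h2 := sign_mul_abs (fderiv ℝ G y).det
  have h3 : (((SignType.sign (fderiv ℝ G y).det : SignType) : ℤ) : ℝ) =
      ((SignType.sign (fderiv ℝ G y).det : SignType) : ℝ) := by
    cases SignType.sign (fderiv ℝ G y).det <;> simp
  rw [h3, h2, mul_comm]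

end Regular

/-! ### Proper maps and distance to the boundary values -/

section Proper

theorem ProperOn.continuousOn {X Y : Type*} [TopologicalSpace X] [TopologicalSpace Y] {f : X → Y}
    {S : Set X} (h : ProperOn f S) : ContinuousOn f S :=
  continuousOn_iff_continuous_domRestrict.2 h.continuous

theorem ProperOn.mono {X Y : Type*} [TopologicalSpace X] [TopologicalSpace Y] [T2Space Y]
    [WeaklyLocallyCompactSpace Y] {f : X → Y} {S T : Set X} (h : ProperOn f S) (hT : IsClosed T)
    (hTS : T ⊆ S) : ProperOn f T := by
  rw [properOn_iff] at h ⊢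
  refine ⟨h.1.mono hTS, fun K hK => ?_⟩
  have : T ∩ f ⁻¹' K = S ∩ f ⁻¹' K ∩ T := by
    ext x
    exact ⟨fun hx => ⟨⟨hTS hx.1, hx.2⟩, hx.1⟩, fun hx => ⟨hx.2, hx.1.2⟩⟩
  rw [this]
  exact (h.2 K hK).inter_right hT

theorem ProperOn.isCompact_inter_preimage {X Y : Type*} [TopologicalSpace X] [TopologicalSpace Y]
    [T2Space Y] [WeaklyLocallyCompactSpace Y] {f : X → Y} {S : Set X} (h : ProperOn f S) {K : Set Y}
    (hK : IsCompact K) : IsCompact (S ∩ f ⁻¹' K) :=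
  ((properOn_iff f S).1 h).2 K hK

theorem ProperOn.isClosed_image {X Y : Type*} [TopologicalSpace X] [TopologicalSpace Y] {f : X → Y}
    {S : Set X} (h : ProperOn f S) : IsClosed (f '' S) := by
  have := h.isClosedMap.isClosed_range
  rwa [Set.range_domRestrict] at this

/-- Trades the extended distance for a real bound with room to spare; for empty `A` both sides hold.
-/
theorem ofReal_lt_infEDist_iff {F : Type*} [NormedAddCommGroup F] {y : F} {A : Set F} {s : ℝ} (hs : 0 ≤ s) :
    ENNReal.ofReal s < Metric.infEDist y A ↔ ∃ s' > s, ∀ a ∈ A, s' ≤ ‖a - y‖ := by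
  constructor
  · intro h
    obtain ⟨c, hc0, hc, hcA⟩ := ENNReal.lt_iff_exists_real_btwn.1 h
    refine ⟨c, (ENNReal.ofReal_lt_ofReal_iff_of_nonneg hs).1 hc, fun a ha => ?_⟩
    have := hcA.trans_le (Metric.infEDist_le_edist_of_mem ha)
    rw [edist_dist, dist_comm, dist_eq_norm] at this
    exact ((ENNReal.ofReal_lt_ofReal_iff_of_nonneg hc0).1 this).le
  · rintro ⟨s', hs', h⟩
    refine ((ENNReal.ofReal_lt_ofReal_iff_of_nonneg hs).2 hs').trans_le ?_
    refine Metric.le_infEDist.2 fun a ha => ?_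
    rw [edist_dist, dist_comm, dist_eq_norm]
    exact ENNReal.ofReal_le_ofReal (h a ha)

variable {X F : Type*} [TopologicalSpace X] [NormedAddCommGroup F] [ProperSpace F]

/-- Where `g` lands in `K`, `f` lands in the closed `ε`-thickening of `K`, which is still compact.
-/
theorem ProperOn.of_norm_sub_le {f g : X → F} {S : Set X} (h : ProperOn f S)
    (hS : IsClosed S) (hg : ContinuousOn g S) {ε : ℝ} (hε : ∀ x ∈ S, ‖g x - f x‖ ≤ ε) :
    ProperOn g S := by
  rw [properOn_iff]
  refine ⟨hg, fun K hK => ?_⟩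
  have hc : IsCompact (S ∩ f ⁻¹' Metric.cthickening ε K) :=
    h.isCompact_inter_preimage hK.cthickening
  refine hc.of_isClosed_subset (hg.preimage_isClosed_of_isClosed hS hK.isClosed) ?_
  rintro x ⟨hx, hxK⟩
  refine ⟨hx, Metric.mem_cthickening_of_dist_le (f x) (g x) ε K hxK ?_⟩
  rw [dist_comm, dist_eq_norm]
  exact hε x hx

/-- Proper maps have closed image, so a missed value is missed by a positive distance, even if `T`
is not compact. -/
theorem ProperOn.exists_le_norm_sub {f : X → F} {S T : Set X} (h : ProperOn f S) (hT : IsClosed T)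
    (hTS : T ⊆ S) {y : F} (hy : ∀ x ∈ T, f x ≠ y) : ∃ δ > 0, ∀ x ∈ T, δ ≤ ‖f x - y‖ := by
  have hc : IsOpen (f '' T)ᶜ := (h.mono hT hTS).isClosed_image.isOpen_compl
  obtain ⟨δ, hδ, hb⟩ := Metric.isOpen_iff.1 hc y (by rintro ⟨x, hx, rfl⟩; exact hy x hx rfl)
  refine ⟨δ, hδ, fun x hx => le_of_not_gt fun hlt => hb ?_ (mem_image_of_mem f hx)⟩
  rwa [Metric.mem_ball, dist_eq_norm]

end Proper

/-! ### Smooth approximation and regular values -/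

section Smooth

variable {k : ℕ} {f g : EuclideanSpace ℝ (Fin k) → EuclideanSpace ℝ (Fin k)}
  {U S : Set (EuclideanSpace ℝ (Fin k))} {y z : EuclideanSpace ℝ (Fin k)}

/-- Smooth cutoff functions. -/
theorem exists_contDiff_cutoff {E : Type*} [NormedAddCommGroup E] [NormedSpace ℝ E]
    [FiniteDimensional ℝ E] {K U : Set E} (hK : IsCompact K) (hU : IsOpen U) (hKU : K ⊆ U) :
    ∃ χ : E → ℝ, ContDiff ℝ ∞ χ ∧ HasCompactSupport χ ∧ tsupport χ ⊆ U ∧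
      ∀ᶠ x in 𝓝ˢ K, χ x = 1 := by
  obtain ⟨L, hL, hKL, hLU⟩ := exists_compact_between hK hU hKU
  obtain ⟨χ, h1, h0, -⟩ := exists_contMDiffMap_one_nhds_of_subset_interior (n := ⊤) 𝓘(ℝ, E)
    hK.isClosed hKL
  have hsub : tsupport χ ⊆ L :=
    closure_minimal (fun x hx => by_contra fun hxL => hx (h0 x hxL)) hL.isClosed
  exact ⟨χ, χ.contMDiff.contDiff, hL.of_isClosed_subset (isClosed_tsupport _) hsub,
    hsub.trans hLU, h1⟩

/-- The local extension is multiplied by a cutoff equal to `1` near `S` and zero off a neighbourhood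
whose closure lies in `V`. -/
theorem SmoothOn.exists_contDiff_eqOn (h : SmoothOn f S) (hS : IsClosed S) :
    ∃ G : EuclideanSpace ℝ (Fin k) → EuclideanSpace ℝ (Fin k), ContDiff ℝ ∞ G ∧ EqOn G f S := by
  obtain ⟨V, F, hV, hSV, hF, hFf⟩ := h
  obtain ⟨W, hW, hSW, hWV⟩ := normal_exists_closure_subset hS hV hSV
  obtain ⟨χ, h1, h0, -⟩ := exists_contMDiffMap_one_nhds_of_subset_interior (n := ⊤)
    𝓘(ℝ, EuclideanSpace ℝ (Fin k)) hS (t := W) (by rwa [hW.interior_eq])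
  refine ⟨fun x => χ x • F x, ?_, fun x hx => ?_⟩
  · rw [contDiff_iff_contDiffAt]
    intro x
    by_cases hx : x ∈ closure W
    · exact χ.contMDiff.contDiff.contDiffAt.smul (hF.contDiffAt (hV.mem_nhds (hWV hx)))
    · refine (contDiffAt_const (c := 0)).congr_of_eventuallyEq ?_
      filter_upwards [isClosed_closure.isOpen_compl.mem_nhds hx] with z hz
      rw [h0 z fun hzW => hz (subset_closure hzW), zero_smul]
  · simp only [h1.self_of_nhdsSet x hx, one_smul, hFf hx]

/-- Approximation of a continuous map by a smooth one with a regular value near a given point. -/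
theorem exists_contDiff_approx_regular_value (hf : ContinuousOn f S) (hS : IsClosed S)
    (y : EuclideanSpace ℝ (Fin k)) {δ : ℝ} (hδ : 0 < δ) :
    ∃ (g : EuclideanSpace ℝ (Fin k) → EuclideanSpace ℝ (Fin k)) (z : EuclideanSpace ℝ (Fin k)),
      ContDiff ℝ ∞ g ∧ (∀ x ∈ S, ‖g x - f x‖ ≤ δ) ∧ ‖z - y‖ ≤ δ ∧
      ∀ x, g x = z → Function.Surjective (fderiv ℝ g x) := by
  -- Tietze extension, so that a globally continuous map can be smoothed.
  obtain ⟨F, hF⟩ := ContinuousMap.exists_restrict_eq hS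
    ⟨S.domRestrict f, continuousOn_iff_continuous_domRestrict.1 hf⟩
  obtain ⟨g, hg, hgF, -⟩ := F.continuous.exists_contDiff_approx ⊤ (ε := fun _ => δ)
    continuous_const fun _ => hδ
  -- Sard's theorem in equal dimensions; a null set of critical values cannot fill a ball.
  have hsard : volume (g '' {x | (fderiv ℝ g x).det = 0}) = 0 :=
    addHaar_image_eq_zero_of_det_fderivWithin_eq_zero volume
      (fun x _ => (hg.differentiable (by simp) x).hasFDerivAt.hasFDerivWithinAt) fun x hx => hx
  obtain ⟨z, hzb, hz⟩ : ∃ z ∈ Metric.ball y δ, z ∉ g '' {x | (fderiv ℝ g x).det = 0} := by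
    by_contra! hcon
    exact (Metric.measure_ball_pos volume y hδ).ne' (measure_mono_null hcon hsard)
  refine ⟨g, z, hg, fun x hx => ?_, ?_, fun x hx => ?_⟩
  · have h1 : F x = f x := congrArg (fun q => q ⟨x, hx⟩) hF
    rw [← h1, ← dist_eq_norm]
    exact (hgF x).le
  · rw [← dist_eq_norm]
    exact (Metric.mem_ball.1 hzb).le
  · rw [← det_ne_zero_iff_surjective]
    exact fun h0 => hz ⟨x, h0, hx⟩

/-- With `σ = ε`, the condition `2 * ε < δ` gives the gap and also excludes `g x = z` on the
frontier, where it would force `‖f x - y‖ ≤ 2 * ε`. -/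
theorem IsAdmissible.isRegularApprox (hf : IsAdmissible f U y) (hg : ContDiff ℝ ∞ g) {ε δ : ℝ}
    (hε : 0 < ε) (hgf : ∀ x ∈ closure U, ‖g x - f x‖ ≤ ε) (hzy : ‖z - y‖ ≤ ε) (hεδ : 2 * ε < δ)
    (hδ : ∀ x ∈ frontier U, δ ≤ ‖f x - y‖)
    (hreg : ∀ x, g x = z → Function.Surjective (fderiv ℝ g x)) : IsRegularApprox f U y g z := by
  refine ⟨⟨⟨hf.isOpen, hf.proper.of_norm_sub_le isClosed_closure hg.continuous.continuousOn hgf,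
    fun x hx hxz => ?_⟩, ⟨univ, g, isOpen_univ, subset_univ _, hg.contDiffOn, fun _ _ => rfl⟩,
    fun x _ => hreg x⟩, ε, ε, hε, hε, hgf, hzy, ?_⟩
  · have h1 := hδ x hx
    have h2 := hgf x (frontier_subset_closure hx)
    have h3 : f x - y = (z - y) - (g x - f x) := by rw [hxz]; abel
    have h4 := norm_sub_le (z - y) (g x - f x)
    rw [← h3] at h4
    linarith
  · rw [ofReal_lt_infEDist_iff (by positivity)]
    exact ⟨δ, by linarith, by rintro _ ⟨x, hx, rfl⟩; exact hδ x hx⟩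

theorem IsAdmissible.exists_boundary_bound (hf : IsAdmissible f U y) :
    ∃ δ > 0, ∀ x ∈ frontier U, δ ≤ ‖f x - y‖ :=
  hf.proper.exists_le_norm_sub isClosed_frontier frontier_subset_closure hf.boundary

theorem IsAdmissible.exists_isRegularApprox (hf : IsAdmissible f U y) :
    ∃ g z, IsRegularApprox f U y g z := by
  obtain ⟨δ, hδ, hb⟩ := hf.exists_boundary_bound
  obtain ⟨g, z, hg, hgf, hzy, hreg⟩ := exists_contDiff_approx_regular_value hf.proper.continuousOn
    isClosed_closure y (δ := δ / 3) (by positivity)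
  exact ⟨g, z, hf.isRegularApprox hg (by positivity) hgf hzy (by linarith) hb hreg⟩

/-- No solution lies on the frontier, so the fibre in `U` is the fibre in `closure U`, compact by
properness. -/
theorem IsAdmissible.isCompact_fiber (hf : IsAdmissible f U y) : IsCompact (f ⁻¹' {y} ∩ U) := by
  have h := hf.proper.isCompact_inter_preimage (isCompact_singleton (x := y))
  have : f ⁻¹' {y} ∩ U = closure U ∩ f ⁻¹' {y} := by
    ext x
    refine ⟨fun hx => ⟨subset_closure hx.2, hx.1⟩, fun hx => ⟨hx.2, by_contra fun hxU => ?_⟩⟩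
    exact hf.boundary x (by rw [hf.isOpen.frontier_eq]; exact ⟨hx.1, hxU⟩) hx.2
  rwa [this]

/-- Regular triples may be replaced by globally smooth maps. -/
theorem IsRegular.exists_contDiff (h : IsRegular g U z) :
    ∃ G : EuclideanSpace ℝ (Fin k) → EuclideanSpace ℝ (Fin k), ContDiff ℝ ∞ G ∧
      EqOn G g (closure U) ∧ (∀ x ∈ U, fderiv ℝ G x = fderiv ℝ g x) ∧
      ∀ x ∈ U, G x = z → (fderiv ℝ G x).det ≠ 0 := by
  obtain ⟨G, hG, hGg⟩ := h.smooth.exists_contDiff_eqOn isClosed_closure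
  have hd : ∀ x ∈ U, fderiv ℝ G x = fderiv ℝ g x := fun x hx =>
    Filter.EventuallyEq.fderiv_eq
      (eventually_of_mem (h.admissible.isOpen.mem_nhds hx) fun u hu => hGg (subset_closure hu))
  refine ⟨G, hG, hGg, hd, fun x hx hxz => ?_⟩
  rw [det_ne_zero_iff_surjective, hd x hx]
  exact h.regular x hx (by rw [← hGg (subset_closure hx), hxz])

theorem IsRegular.finite_fiber (h : IsRegular g U z) : (g ⁻¹' {z} ∩ U).Finite := by
  obtain ⟨G, hG, hGg, -, hdet⟩ := h.exists_contDiff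
  have hGz : ∀ x ∈ g ⁻¹' {z} ∩ U, G x = z := fun x hx => (hGg (subset_closure hx.2)).trans hx.1
  exact finite_of_isCompact_of_det_ne_zero (hG.of_le (by simp)) h.admissible.isCompact_fiber hGz
    fun x hx => hdet x hx.2 (hGz x hx)

end Smooth

/-! ### Independence of the regular approximation -/

section WellDefined

variable {k : ℕ} {f g g₀ g₁ : EuclideanSpace ℝ (Fin k) → EuclideanSpace ℝ (Fin k)}
  {U : Set (EuclideanSpace ℝ (Fin k))} {y z z₀ z₁ : EuclideanSpace ℝ (Fin k)}

/-- The degree integral computes the regular degree. -/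
theorem IsRegular.exists_integral_eq (h : IsRegular g U z)
    {G : EuclideanSpace ℝ (Fin k) → EuclideanSpace ℝ (Fin k)} (hG : ContDiff ℝ ∞ G)
    (hGg : EqOn G g (closure U)) (hd : ∀ x ∈ U, fderiv ℝ G x = fderiv ℝ g x)
    (hdet : ∀ x ∈ U, G x = z → (fderiv ℝ G x).det ≠ 0) {χ : EuclideanSpace ℝ (Fin k) → ℝ}
    (hχ : Continuous χ) (hχc : HasCompactSupport χ) (hχU : tsupport χ ⊆ U)
    (hχ1 : ∀ x ∈ U, g x = z → ∀ᶠ u in 𝓝 x, χ u = 1) :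
    ∃ r > 0, ∀ φ : EuclideanSpace ℝ (Fin k) → ℝ, Continuous φ → (∀ u, r ≤ ‖u‖ → φ u = 0) →
      ∫ x, χ x * (φ (G x - z) * (fderiv ℝ (fun x => G x - z) x).det) =
        (regularDegree g U z : ℝ) * ∫ u, φ u := by
  have hmem : ∀ x, x ∈ h.finite_fiber.toFinset ↔ g x = z ∧ x ∈ U := fun x => by
    rw [Set.Finite.mem_toFinset]; rfl
  have hfd : ∀ x, fderiv ℝ (fun x => G x - z) x = fderiv ℝ G x := fun x => fderiv_sub_const z
  obtain ⟨r, hr, H⟩ := exists_integral_eq_sum_sign volume (χ := χ) (G := fun x => G x - z)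
    ((hG.sub contDiff_const).of_le (by simp)) hχ hχc h.finite_fiber.toFinset
    (fun x hx hx0 => (hmem x).2
      ⟨(hGg (subset_closure (hχU hx))).symm.trans (sub_eq_zero.1 hx0), hχU hx⟩)
    (fun x hx => sub_eq_zero.2 ((hGg (subset_closure ((hmem x).1 hx).2)).trans ((hmem x).1 hx).1))
    (fun x hx => hχ1 x ((hmem x).1 hx).2 ((hmem x).1 hx).1)
    (fun x hx => by
      rw [hfd]
      exact hdet x ((hmem x).1 hx).2
        ((hGg (subset_closure ((hmem x).1 hx).2)).trans ((hmem x).1 hx).1))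
  refine ⟨r, hr, fun φ hφ hφr => (H φ hφ hφr).trans ?_⟩
  congr 2
  rw [regularDegree, finsum_mem_eq_finite_toFinset_sum _ h.finite_fiber]
  refine Finset.sum_congr rfl fun x hx => ?_
  rw [hfd, hd x ((hmem x).1 hx).2, index]

/-- Any two regular approximations of an admissible triple have the same degree. -/
theorem IsAdmissible.regularDegree_eq (hf : IsAdmissible f U y) (h₀ : IsRegularApprox f U y g₀ z₀)
    (h₁ : IsRegularApprox f U y g₁ z₁) : regularDegree g₀ U z₀ = regularDegree g₁ U z₁ := by
  obtain ⟨hr₀, ε₀, σ₀, hε₀, hσ₀, hg₀, hz₀, hb₀⟩ := h₀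
  obtain ⟨hr₁, ε₁, σ₁, hε₁, hσ₁, hg₁, hz₁, hb₁⟩ := h₁
  rw [ofReal_lt_infEDist_iff (by positivity)] at hb₀ hb₁
  obtain ⟨s₀, hs₀, hb₀⟩ := hb₀
  obtain ⟨s₁, hs₁, hb₁⟩ := hb₁
  -- `s` is the larger total tolerance, and `m` the midpoint between it and its own boundary bound.
  obtain ⟨s, m, hs0, hs1, hsm, hm⟩ : ∃ s m : ℝ, ε₀ + σ₀ ≤ s ∧ ε₁ + σ₁ ≤ s ∧ s < m ∧
      ∀ x ∈ frontier U, m < ‖f x - y‖ := by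
    rcases le_total (ε₀ + σ₀) (ε₁ + σ₁) with hle | hle
    · exact ⟨ε₁ + σ₁, (ε₁ + σ₁ + s₁) / 2, hle, le_rfl, by linarith, fun x hx => by
        linarith [hb₁ _ (mem_image_of_mem f hx)]⟩
    · exact ⟨ε₀ + σ₀, (ε₀ + σ₀ + s₀) / 2, le_rfl, hle, by linarith, fun x hx => by
        linarith [hb₀ _ (mem_image_of_mem f hx)]⟩
  have hK : IsCompact (closure U ∩ f ⁻¹' Metric.closedBall y m) :=
    hf.proper.isCompact_inter_preimage (isCompact_closedBall y m)
  have hKU : closure U ∩ f ⁻¹' Metric.closedBall y m ⊆ U := by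
    rintro x ⟨hx, hxm⟩
    by_contra hxU
    have := hm x (by rw [hf.isOpen.frontier_eq]; exact ⟨hx, hxU⟩)
    rw [mem_preimage, Metric.mem_closedBall, dist_eq_norm] at hxm
    linarith
  obtain ⟨χ, hχ, hχc, hχU, hχ1⟩ := exists_contDiff_cutoff hK hf.isOpen hKU
  rw [eventually_nhdsSet_iff_forall] at hχ1
  obtain ⟨G₀, hG₀, hGg₀, hd₀, hdet₀⟩ := hr₀.exists_contDiff
  obtain ⟨G₁, hG₁, hGg₁, hd₁, hdet₁⟩ := hr₁.exists_contDiff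
  have hdist₀ : ∀ x ∈ closure U, ‖(G₀ x - z₀) - (f x - y)‖ ≤ s := fun x hx => by
    have e : (G₀ x - z₀) - (f x - y) = (g₀ x - f x) - (z₀ - y) := by rw [hGg₀ hx]; abel
    rw [e]
    exact (norm_sub_le _ _).trans ((add_le_add (hg₀ x hx) hz₀).trans hs0)
  have hdist₁ : ∀ x ∈ closure U, ‖(G₁ x - z₁) - (f x - y)‖ ≤ s := fun x hx => by
    have e : (G₁ x - z₁) - (f x - y) = (g₁ x - f x) - (z₁ - y) := by rw [hGg₁ hx]; abel
    rw [e]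
    exact (norm_sub_le _ _).trans ((add_le_add (hg₁ x hx) hz₁).trans hs1)
  -- Used with `v = 0` to place the solutions of both approximations in the set where `χ = 1`, and
  -- with `v` the value of the affine homotopy to control `χ'`.
  have hmemK : ∀ x ∈ closure U, ∀ v : EuclideanSpace ℝ (Fin k), ‖v - (f x - y)‖ ≤ s →
      ‖v‖ < m - s → x ∈ closure U ∩ f ⁻¹' Metric.closedBall y m := by
    intro x hx v hv hvm
    refine ⟨hx, ?_⟩
    rw [mem_preimage, Metric.mem_closedBall, dist_eq_norm]
    have := norm_sub_le v (v - (f x - y))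
    rw [sub_sub_cancel] at this
    linarith
  obtain ⟨r₀, hr₀pos, H₀⟩ := hr₀.exists_integral_eq hG₀ hGg₀ hd₀ hdet₀ hχ.continuous hχc hχU
    fun x hx hxz => hχ1 x (hmemK x (subset_closure hx) 0 (by
      simpa [hGg₀ (subset_closure hx), hxz] using hdist₀ x (subset_closure hx))
      (by simpa using hsm))
  obtain ⟨r₁, hr₁pos, H₁⟩ := hr₁.exists_integral_eq hG₁ hGg₁ hd₁ hdet₁ hχ.continuous hχc hχU
    fun x hx hxz => hχ1 x (hmemK x (subset_closure hx) 0 (by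
      simpa [hGg₁ (subset_closure hx), hxz] using hdist₁ x (subset_closure hx))
      (by simpa using hsm))
  -- `m - s` serves the homotopy; `r₀` and `r₁` serve the two evaluations of the integral.
  obtain ⟨r, hr, hrm, hrr₀, hrr₁⟩ : ∃ r > 0, r ≤ m - s ∧ r ≤ r₀ ∧ r ≤ r₁ :=
    ⟨min (m - s) (min r₀ r₁), lt_min (by linarith) (lt_min hr₀pos hr₁pos), min_le_left _ _,
      (min_le_right _ _).trans (min_le_left _ _), (min_le_right _ _).trans (min_le_right _ _)⟩
  let φ : ContDiffBump (0 : EuclideanSpace ℝ (Fin k)) := ⟨r / 2, r, by positivity, by linarith⟩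
  have hφr : ∀ u, r ≤ ‖u‖ → φ u = 0 := fun u hu => φ.zero_of_le_dist (by simpa using hu)
  have hφpos : 0 < ∫ u, φ u := φ.integral_pos
  have I₀ := H₀ φ φ.continuous fun u hu => hφr u (hrr₀.trans hu)
  have I₁ := H₁ φ φ.continuous fun u hu => hφr u (hrr₁.trans hu)
  have hhom := integral_affine_family_eq volume (χ := χ) (φ := φ) (a := fun x => G₀ x - z₀)
    (w := fun x => (G₁ x - z₁) - (G₀ x - z₀)) (hχ.of_le (by simp)) hχc φ.contDiff
    ((hG₀.sub contDiff_const).of_le (WithTop.coe_le_coe.2 (le_top : (2 : ℕ∞) ≤ ⊤)))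
    (((hG₁.sub contDiff_const).sub (hG₀.sub contDiff_const)).of_le (WithTop.coe_le_coe.2 (le_top : (2 : ℕ∞) ≤ ⊤)))
    (by
      intro t ht x hx
      have hxU : x ∈ closure U := subset_closure (hχU (support_fderiv_subset ℝ hx))
      refine hφr _ (hrm.trans (le_of_not_gt fun hlt => hx ?_))
      have hxK := hmemK x hxU _ (by
        -- By convexity the whole affine homotopy stays within `s` of `f - y`.
        have e : G₀ x - z₀ + t • (G₁ x - z₁ - (G₀ x - z₀)) - (f x - y) =
          (1 - t) • ((G₀ x - z₀) - (f x - y)) + t • ((G₁ x - z₁) - (f x - y)) := by module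
        rw [e]
        refine (norm_add_le _ _).trans ?_
        rw [norm_smul, norm_smul, Real.norm_of_nonneg ht.1, Real.norm_of_nonneg (sub_nonneg.2 ht.2)]
        have h1 := mul_le_mul_of_nonneg_left (hdist₀ x hxU) (sub_nonneg.2 ht.2)
        have h2 := mul_le_mul_of_nonneg_left (hdist₁ x hxU) ht.1
        linarith) hlt
      have hc : χ =ᶠ[𝓝 x] fun _ => 1 := hχ1 x hxK
      rw [hc.fderiv_eq, fderiv_const_apply])
  simp only [add_sub_cancel] at hhom
  rw [I₀, I₁] at hhom
  exact_mod_cast mul_right_cancel₀ hφpos.ne' hhom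

theorem IsAdmissible.degree_eq (hf : IsAdmissible f U y) (h : IsRegularApprox f U y g z) :
    degree f U y = regularDegree g U z := by
  have hex : ∃ p : (EuclideanSpace ℝ (Fin k) → EuclideanSpace ℝ (Fin k)) ×
      EuclideanSpace ℝ (Fin k), IsRegularApprox f U y p.1 p.2 := ⟨(g, z), h⟩
  rw [degree, dif_pos hex]
  exact hf.regularDegree_eq hex.choose_spec h

end WellDefined

/-! ### Normalization, additivity and excision -/

section Properties

variable {k : ℕ} {f f₀ f₁ : EuclideanSpace ℝ (Fin k) → EuclideanSpace ℝ (Fin k)}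
  {U U₁ U₂ : Set (EuclideanSpace ℝ (Fin k))} {y y₀ y₁ : EuclideanSpace ℝ (Fin k)}

theorem isAdmissible_id :
    IsAdmissible (id : EuclideanSpace ℝ (Fin k) → EuclideanSpace ℝ (Fin k)) univ 0 := by
  refine ⟨isOpen_univ, ?_, by simp⟩
  rw [properOn_iff]
  exact ⟨continuousOn_id, fun K hK => by simpa using hK⟩

theorem degree_id :
    degree (id : EuclideanSpace ℝ (Fin k) → EuclideanSpace ℝ (Fin k)) univ 0 = 1 := by
  -- The frontier of the whole space is empty, so any positive `ε` and any `δ > 2 * ε` would do.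
  rw [isAdmissible_id.degree_eq (isAdmissible_id.isRegularApprox contDiff_id (ε := 1) (δ := 3)
    one_pos (by simp) (z := 0) (by simp) (by norm_num) (by simp)
    (fun x _ => by rw [fderiv_id]; exact Function.surjective_id))]
  have : (id : EuclideanSpace ℝ (Fin k) → EuclideanSpace ℝ (Fin k)) ⁻¹' {0} ∩ univ = {0} := by simp
  rw [regularDegree, this, finsum_mem_singleton, index, fderiv_id]
  have hdet : (ContinuousLinearMap.id ℝ (EuclideanSpace ℝ (Fin k))).det = 1 := LinearMap.det_id
  rw [hdet]
  simp

theorem IsAdmissible.of_subset (hf : IsAdmissible f U y) (hU₁ : IsOpen U₁) (hU₁U : U₁ ⊆ U)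
    (h : ∀ x ∈ frontier U₁, x ∈ U → f x ≠ y) : IsAdmissible f U₁ y := by
  refine ⟨hU₁, hf.proper.mono isClosed_closure (closure_mono hU₁U), fun x hx => ?_⟩
  by_cases hxU : x ∈ U
  · exact h x hx hxU
  · refine hf.boundary x ?_
    rw [hf.isOpen.frontier_eq]
    exact ⟨closure_mono hU₁U (frontier_subset_closure hx), hxU⟩

/-- One of the two subdomains in the additivity property is admissible. -/
theorem IsAdmissible.of_fiber_subset (hf : IsAdmissible f U y) (hU₁ : IsOpen U₁) (hU₂ : IsOpen U₂)
    (hU₁U : U₁ ⊆ U) (hdisj : Disjoint U₁ U₂) (hfib : f ⁻¹' {y} ∩ U ⊆ U₁ ∪ U₂) :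
    IsAdmissible f U₁ y := by
  refine hf.of_subset hU₁ hU₁U fun x hx hxU hxy => ?_
  rw [hU₁.frontier_eq] at hx
  rcases hfib ⟨hxy, hxU⟩ with h1 | h2
  · exact hx.2 h1
  · exact (hdisj.closure_left hU₂).le_bot ⟨hx.1, h2⟩

/-- All three frontiers lie in the closed set `closure U \ (U₁ ∪ U₂)`, on which `f` stays `δ` away
from `y`. A `δ / 3`-approximation is therefore valid for `U`, `U₁` and `U₂` at once and takes the
value `z` in `U` only inside `U₁ ∪ U₂`, so the finite sum splits. -/
theorem IsAdmissible.degree_add (hf : IsAdmissible f U y) (hU₁ : IsOpen U₁) (hU₂ : IsOpen U₂)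
    (hU₁U : U₁ ⊆ U) (hU₂U : U₂ ⊆ U) (hdisj : Disjoint U₁ U₂)
    (hfib : f ⁻¹' {y} ∩ U ⊆ U₁ ∪ U₂) : degree f U y = degree f U₁ y + degree f U₂ y := by
  have hf₁ := hf.of_fiber_subset hU₁ hU₂ hU₁U hdisj hfib
  have hf₂ := hf.of_fiber_subset hU₂ hU₁ hU₂U hdisj.symm (by rwa [union_comm])
  have hT : IsClosed (closure U \ (U₁ ∪ U₂)) := isClosed_closure.sdiff (hU₁.union hU₂)
  obtain ⟨δ, hδ, hb⟩ := hf.proper.exists_le_norm_sub (y := y) hT sdiff_subset (by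
    rintro x ⟨hx, hxU⟩ hxy
    by_cases hxU' : x ∈ U
    · exact hxU (hfib ⟨hxy, hxU'⟩)
    · exact hf.boundary x (by rw [hf.isOpen.frontier_eq]; exact ⟨hx, hxU'⟩) hxy)
  have hfr : frontier U ⊆ closure U \ (U₁ ∪ U₂) := by
    rw [hf.isOpen.frontier_eq]
    exact sdiff_subset_sdiff_right (union_subset hU₁U hU₂U)
  have hfr₁ : frontier U₁ ⊆ closure U \ (U₁ ∪ U₂) := by
    rw [hU₁.frontier_eq]
    refine fun x hx => ⟨closure_mono hU₁U hx.1, ?_⟩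
    rintro (h1 | h2)
    · exact hx.2 h1
    · exact (hdisj.closure_left hU₂).le_bot ⟨hx.1, h2⟩
  have hfr₂ : frontier U₂ ⊆ closure U \ (U₁ ∪ U₂) := by
    rw [hU₂.frontier_eq]
    refine fun x hx => ⟨closure_mono hU₂U hx.1, ?_⟩
    rintro (h1 | h2)
    · exact (hdisj.symm.closure_left hU₁).le_bot ⟨hx.1, h1⟩
    · exact hx.2 h2
  obtain ⟨g, z, hg, hgf, hzy, hreg⟩ := exists_contDiff_approx_regular_value hf.proper.continuousOn
    isClosed_closure y (δ := δ / 3) (by positivity)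
  have ha := hf.isRegularApprox hg (by positivity) hgf hzy (by linarith)
    (fun x hx => hb x (hfr hx)) hreg
  have ha₁ := hf₁.isRegularApprox hg (by positivity) (fun x hx => hgf x (closure_mono hU₁U hx)) hzy
    (by linarith) (fun x hx => hb x (hfr₁ hx)) hreg
  have ha₂ := hf₂.isRegularApprox hg (by positivity) (fun x hx => hgf x (closure_mono hU₂U hx)) hzy
    (by linarith) (fun x hx => hb x (hfr₂ hx)) hreg
  rw [hf.degree_eq ha, hf₁.degree_eq ha₁, hf₂.degree_eq ha₂]
  have hsplit : g ⁻¹' {z} ∩ U = (g ⁻¹' {z} ∩ U₁) ∪ (g ⁻¹' {z} ∩ U₂) := by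
    rw [← inter_union_distrib_left]
    refine Subset.antisymm (fun x hx => ⟨hx.1, by_contra fun hxU => ?_⟩)
      (inter_subset_inter_right _ (union_subset hU₁U hU₂U))
    have h1 := hb x ⟨subset_closure hx.2, hxU⟩
    have h2 := hgf x (subset_closure hx.2)
    have h3 : f x - y = (z - y) - (g x - f x) := by rw [hx.1]; abel
    have h4 := norm_sub_le (z - y) (g x - f x)
    rw [← h3] at h4
    linarith
  rw [regularDegree, hsplit, finsum_mem_union (hdisj.mono inter_subset_right inter_subset_right)
    ha₁.1.finite_fiber ha₂.1.finite_fiber]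
  rfl

/-- Makes excision the case `U₂ = ∅` of additivity. -/
theorem degree_empty : degree f ∅ y = 0 := by
  rw [degree]
  split_ifs with h
  · simp [regularDegree]
  · rfl

theorem IsAdmissible.degree_excision (hf : IsAdmissible f U y) (hU₁ : IsOpen U₁) (hU₁U : U₁ ⊆ U)
    (hfib : f ⁻¹' {y} ∩ U ⊆ U₁) : IsAdmissible f U₁ y ∧ degree f U y = degree f U₁ y := by
  have h : f ⁻¹' {y} ∩ U ⊆ U₁ ∪ ∅ := by rwa [union_empty]
  refine ⟨hf.of_fiber_subset hU₁ isOpen_empty hU₁U (disjoint_empty _) h, ?_⟩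
  rw [hf.degree_add hU₁ isOpen_empty hU₁U (empty_subset _) (disjoint_empty _) h, degree_empty,
    add_zero]

/-- Stability of the degree under small perturbations. -/
theorem IsAdmissible.degree_eq_of_close (hf₀ : IsAdmissible f₀ U y₀) (hf₁ : IsAdmissible f₁ U y₁)
    {δ : ℝ} (hδ : 0 < δ) (hb₀ : ∀ x ∈ frontier U, δ ≤ ‖f₀ x - y₀‖)
    (hb₁ : ∀ x ∈ frontier U, δ ≤ ‖f₁ x - y₁‖) (hf : ∀ x ∈ closure U, ‖f₀ x - f₁ x‖ ≤ δ / 4)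
    (hy : ‖y₀ - y₁‖ ≤ δ / 4) : degree f₀ U y₀ = degree f₁ U y₁ := by
  obtain ⟨g, z, hg, hgf, hzy, hreg⟩ := exists_contDiff_approx_regular_value
    hf₀.proper.continuousOn isClosed_closure y₀ (δ := δ / 8) (by positivity)
  -- The same `(g, z)` approximates both triples: the tolerance for the second is `δ / 8 + δ / 4`,
  -- whose double is still below `δ`.
  rw [hf₀.degree_eq (hf₀.isRegularApprox hg (by positivity) hgf hzy (by linarith) hb₀ hreg),
    hf₁.degree_eq (hf₁.isRegularApprox hg (ε := δ / 8 + δ / 4) (by positivity)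
      (fun x hx => (norm_sub_le_norm_sub_add_norm_sub _ (f₀ x) _).trans
        (add_le_add (hgf x hx) (hf x hx)))
      ((norm_sub_le_norm_sub_add_norm_sub _ y₀ _).trans (add_le_add hzy hy))
      (by linarith) hb₁ hreg)]

/-! ### Homotopy invariance -/

variable {H : EuclideanSpace ℝ (Fin k) × ℝ → EuclideanSpace ℝ (Fin k)}
  {α : ℝ → EuclideanSpace ℝ (Fin k)}

/-- Properness passes to a slice because its preimages are projections of closed slices of compact
preimages under `H`. -/
theorem IsAdmissibleHomotopy.isAdmissible (h : IsAdmissibleHomotopy H U α) {t : ℝ}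
    (ht : t ∈ Icc (0 : ℝ) 1) : IsAdmissible (fun x => H (x, t)) U (α t) := by
  refine ⟨h.isOpen, ?_, fun x hx => h.boundary x hx t ht⟩
  rw [properOn_iff]
  refine ⟨h.proper.continuousOn.comp (by fun_prop) fun x hx => ⟨hx, ht⟩, fun K hK => ?_⟩
  have hc := (h.proper.isCompact_inter_preimage hK).inter_right
    (isClosed_singleton.preimage continuous_snd : IsClosed (Prod.snd ⁻¹' {t}))
  convert hc.image continuous_fst using 1
  ext x
  constructor
  · rintro ⟨hx, hxK⟩
    exact ⟨(x, t), ⟨⟨⟨hx, ht⟩, hxK⟩, rfl⟩, rfl⟩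
  · rintro ⟨⟨x, t'⟩, ⟨⟨⟨hx, -⟩, hxK⟩, rfl⟩, rfl⟩
    exact ⟨hx, hxK⟩

/-- The zeros of an admissible homotopy lie in a compact subset of the domain. -/
theorem IsAdmissibleHomotopy.exists_isCompact (h : IsAdmissibleHomotopy H U α) :
    ∃ K, IsCompact K ∧ K ⊆ U ∧ ∀ x ∈ U, ∀ t ∈ Icc (0 : ℝ) 1, H (x, t) = α t → x ∈ K := by
  -- The path has compact image, so its preimage is compact; the solutions of `H = α` form a closed
  -- part of it, and `K` is their projection.
  have hc := h.proper.isCompact_inter_preimage (isCompact_Icc.image_of_continuousOn h.path)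
  have hP : IsCompact (closure U ×ˢ Icc (0 : ℝ) 1 ∩ H ⁻¹' (α '' Icc 0 1) ∩
      (closure U ×ˢ Icc (0 : ℝ) 1 ∩ (fun p => H p - α p.2) ⁻¹' {0})) := by
    refine hc.inter_right (ContinuousOn.preimage_isClosed_of_isClosed ?_
      (isClosed_closure.prod isClosed_Icc) isClosed_singleton)
    exact h.proper.continuousOn.sub (h.path.comp continuousOn_snd fun p hp => hp.2)
  refine ⟨_, hP.image continuous_fst, ?_, fun x hx t ht hxt => ?_⟩
  · rintro _ ⟨⟨x, t⟩, ⟨-, ⟨hx, ht⟩, hxt⟩, rfl⟩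
    by_contra hxU
    exact h.boundary x (by rw [h.isOpen.frontier_eq]; exact ⟨hx, hxU⟩) t ht (sub_eq_zero.1 hxt)
  · have hxc := subset_closure hx
    exact ⟨(x, t), ⟨⟨⟨hxc, ht⟩, t, ht, hxt.symm⟩, ⟨hxc, ht⟩, sub_eq_zero.2 hxt⟩, rfl⟩

/-- Homotopy invariance on bounded domains. -/
theorem IsAdmissibleHomotopy.degree_eq_of_isCompact_closure (h : IsAdmissibleHomotopy H U α)
    (hU : IsCompact (closure U)) :
    degree (fun x => H (x, 0)) U (α 0) = degree (fun x => H (x, 1)) U (α 1) := by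
  have hF : IsCompact (frontier U ×ˢ Icc (0 : ℝ) 1) :=
    (hU.of_isClosed_subset isClosed_frontier frontier_subset_closure).prod isCompact_Icc
  have hcont : ContinuousOn (fun p => H p - α p.2) (frontier U ×ˢ Icc (0 : ℝ) 1) :=
    (h.proper.continuousOn.mono (prod_mono_left frontier_subset_closure)).sub
      (h.path.comp continuousOn_snd fun p hp => hp.2)
  obtain ⟨δ, hδ, hb⟩ := hF.exists_forall_le' (f := fun p => ‖H p - α p.2‖) (a := 0) hcont.norm
    fun p hp => norm_pos_iff.2 (sub_ne_zero.2 (h.boundary p.1 hp.1 p.2 hp.2))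
  have huH := (hU.prod (isCompact_Icc (a := (0 : ℝ)) (b := 1))).uniformContinuousOn_of_continuous
    h.proper.continuousOn
  have huα := isCompact_Icc.uniformContinuousOn_of_continuous h.path
  obtain ⟨η₁, hη₁, hH⟩ := Metric.uniformContinuousOn_iff_le.1 huH (δ / 4) (by positivity)
  obtain ⟨η₂, hη₂, hα⟩ := Metric.uniformContinuousOn_iff_le.1 huα (δ / 4) (by positivity)
  have hloc : ∀ s ∈ Icc (0 : ℝ) 1, ∀ t ∈ Icc (0 : ℝ) 1, dist s t ≤ min η₁ η₂ →
      degree (fun x => H (x, s)) U (α s) = degree (fun x => H (x, t)) U (α t) := by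
    intro s hs t ht hst
    refine (h.isAdmissible hs).degree_eq_of_close (h.isAdmissible ht) hδ
      (fun x hx => hb (x, s) ⟨hx, hs⟩) (fun x hx => hb (x, t) ⟨hx, ht⟩) (fun x hx => ?_) ?_
    · rw [← dist_eq_norm]
      refine hH (x, s) ⟨hx, hs⟩ (x, t) ⟨hx, ht⟩ ?_
      rw [dist_prod_same_left]
      exact hst.trans (min_le_left _ _)
    · rw [← dist_eq_norm]
      exact hα s hs t ht (hst.trans (min_le_right _ _))
  -- Local constancy is continuity into the discrete space `ℤ`, hence constancy on the connected
  -- interval.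
  have hcd : ContinuousOn (fun t => degree (fun x => H (x, t)) U (α t)) (Icc (0 : ℝ) 1) := by
    intro s hs
    refine continuousWithinAt_const.congr_of_eventuallyEq (f := fun _ => _) ?_ rfl
    filter_upwards [self_mem_nhdsWithin, mem_nhdsWithin_of_mem_nhds
      (Metric.closedBall_mem_nhds s (lt_min hη₁ hη₂))] with t ht hts
    exact hloc t ht s hs hts
  exact isPreconnected_Icc.constant hcd (left_mem_Icc.2 zero_le_one) (right_mem_Icc.2 zero_le_one)

/-- One compact `K ⊆ U` contains the solutions for all `t`, so excision to a neighbourhood `V` of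
`K` with compact closure changes neither end degree. -/
theorem IsAdmissibleHomotopy.degree_eq (h : IsAdmissibleHomotopy H U α) :
    degree (fun x => H (x, 0)) U (α 0) = degree (fun x => H (x, 1)) U (α 1) := by
  obtain ⟨K, hK, hKU, hzero⟩ := h.exists_isCompact
  obtain ⟨V, hV, hKV, hVU, hVc⟩ := exists_open_between_and_isCompact_closure hK h.isOpen hKU
  have hVU' : V ⊆ U := subset_closure.trans hVU
  have hfib : ∀ t ∈ Icc (0 : ℝ) 1, (fun x => H (x, t)) ⁻¹' {α t} ∩ U ⊆ V :=
    fun t ht x hx => hKV (hzero x hx.2 t ht hx.1)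
  have hh : IsAdmissibleHomotopy H V α := by
    refine ⟨hV, h.path, h.proper.mono (isClosed_closure.prod isClosed_Icc)
      (prod_mono_left (closure_mono hVU')), fun x hx t ht => ?_⟩
    exact ((h.isAdmissible ht).degree_excision hV hVU' (hfib t ht)).1.boundary x hx
  have h0 : (0 : ℝ) ∈ Icc (0 : ℝ) 1 := left_mem_Icc.2 zero_le_one
  have h1 : (1 : ℝ) ∈ Icc (0 : ℝ) 1 := right_mem_Icc.2 zero_le_one
  rw [((h.isAdmissible h0).degree_excision hV hVU' (hfib 0 h0)).2,
    ((h.isAdmissible h1).degree_excision hV hVU' (hfib 1 h1)).2,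
    hh.degree_eq_of_isCompact_closure hVc]

end Properties

end BrouwerDegree

open BrouwerDegree in
theorem mainTheorem3 (k : ℕ) :
    -- the degree of regular triples is a finite sum
    (∀ (f : EuclideanSpace ℝ (Fin k) → EuclideanSpace ℝ (Fin k))
        (U : Set (EuclideanSpace ℝ (Fin k))) (y : EuclideanSpace ℝ (Fin k)),
      IsRegular f U y → (f ⁻¹' {y} ∩ U).Finite) ∧
    -- the degree of admissible triples is well defined
    (∀ (f : EuclideanSpace ℝ (Fin k) → EuclideanSpace ℝ (Fin k))
        (U : Set (EuclideanSpace ℝ (Fin k))) (y : EuclideanSpace ℝ (Fin k)),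
      IsAdmissible f U y →
        (∃ g z, IsRegularApprox f U y g z) ∧
        ∀ g z, IsRegularApprox f U y g z → degree f U y = regularDegree g U z) ∧
    -- Normalization
    (IsAdmissible (id : EuclideanSpace ℝ (Fin k) → EuclideanSpace ℝ (Fin k)) Set.univ 0 ∧
      degree (id : EuclideanSpace ℝ (Fin k) → EuclideanSpace ℝ (Fin k)) Set.univ 0 = 1) ∧
    -- Additivity
    (∀ (f : EuclideanSpace ℝ (Fin k) → EuclideanSpace ℝ (Fin k))
        (U U₁ U₂ : Set (EuclideanSpace ℝ (Fin k))) (y : EuclideanSpace ℝ (Fin k)),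
      IsAdmissible f U y → IsOpen U₁ → IsOpen U₂ → U₁ ⊆ U → U₂ ⊆ U → Disjoint U₁ U₂ →
        f ⁻¹' {y} ∩ U ⊆ U₁ ∪ U₂ →
        IsAdmissible f U₁ y ∧ IsAdmissible f U₂ y ∧
        degree f U y = degree f U₁ y + degree f U₂ y) ∧
    -- Homotopy Invariance
    (∀ (H : EuclideanSpace ℝ (Fin k) × ℝ → EuclideanSpace ℝ (Fin k))
        (U : Set (EuclideanSpace ℝ (Fin k))) (α : ℝ → EuclideanSpace ℝ (Fin k)),
      IsAdmissibleHomotopy H U α →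
        IsAdmissible (fun x => H (x, 0)) U (α 0) ∧ IsAdmissible (fun x => H (x, 1)) U (α 1) ∧
        degree (fun x => H (x, 0)) U (α 0) = degree (fun x => H (x, 1)) U (α 1)) := by
  refine ⟨fun f U y h => h.finite_fiber, fun f U y h => ⟨h.exists_isRegularApprox,
    fun g z hg => h.degree_eq hg⟩, ⟨isAdmissible_id, degree_id⟩,
    fun f U U₁ U₂ y h h₁ h₂ hU₁ hU₂ hd hfib => ⟨h.of_fiber_subset h₁ h₂ hU₁ hd hfib,
      h.of_fiber_subset h₂ h₁ hU₂ hd.symm (by rwa [Set.union_comm]),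
      h.degree_add h₁ h₂ hU₁ hU₂ hd hfib⟩,
    fun H U α h => ⟨h.isAdmissible (Set.left_mem_Icc.2 zero_le_one),
      h.isAdmissible (Set.right_mem_Icc.2 zero_le_one), h.degree_eq⟩⟩
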